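/- Convention: in a forcing notion, a stronger condition is the greater one. Let $\mathbb Q_\circledcirc$ be the forcing notion whose conditions are the pairs $\langle a,w\rangle$ with $a$ a finite subset of $2^{<\omega}$ and $w$ a finite subset of $2^\omega$, ordered by: $\langle a_0,w_0\rangle\le\langle a_1,w_1\rangle$ if and only if $a_0\subseteq a_1$, $w_0\subseteq w_1$ and, for all $\eta\in w_0$ and $l\in\omega$, $\eta\restriction l\in a_1$ implies $\eta\restriction l\in a_0$. A forcing notion $\mathbb P$ is *$\sigma$-centered* if it is a union of countably many sets in each of which every finite subset has an upper bound in $\mathbb P$. It is *almost $\omega^\omega$-bounding* if for every $\mathbb P$-name $\dot f$ for an element of $\omega^\omega$ and every $p\in\mathbb P$ there is $g\in\omega^\omega\cap\mathbf V$ such that for every infinite $X\subseteq\omega$, $X\in\mathbf V$, there is $p'\ge p$ with $p'\Vdash(\exists^\infty n\in X)(\dot f(n)<g(n))$. A *perfect tree* is a nonempty $T\subseteq 2^{<\omega}$, closed under initial segments, such that every $s\in T$ has an extension $t\in T$ with $t^\frown 0,t^\frown 1\in T$. 1. $\mathbb Q_\circledcirc$ is an almost $\omega^\omega$-bounding $\sigma$-centered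 partial order. 2. Let $\Gamma$ be the canonical name of the generic filter on $\mathbb Q_\circledcirc$ and let $\dot A$ be the $\mathbb Q_\circledcirc$-name for a subset of $2^{<\omega}$ given by $\Vdash\dot A=\bigcup\{a:(\exists w)(\langle a,w\rangle\in\Gamma)\}$. Then ($\alpha$) $\Vdash(\forall\eta\in 2^\omega\cap\mathbf V)(\forall^\infty n\in\omega)(\eta\restriction n\notin\dot A)$; ($\beta$) $\Vdash$ "if $T\subseteq 2^{<\omega}$ is a perfect tree from the ground model, then $(\exists^\infty n\in\omega)(T\cap 2^n\cap\dot A\ne\emptyset)$". -/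

import Mathlib

namespace PForcing

universe u v

/-! Forcing over the universe of (well-founded, extensional) sets `PSet`.
Convention: a stronger condition is the *greater* one. -/

/-- `P`-names: a name is a family of pairs (name, condition). -/
inductive PName (P : Type u) : Type (u + 1)
  | mk (ι : Type u) (name : ι → PName P) (cond : ι → P) : PName P

/-- A statement of the forcing language, identified with the set of conditions forcing it:
`φ p` reads "`p` forces `φ`". -/
abbrev FProp (P : Type u) : Type u := P → Prop

section Language

variable {P : Type u} [Preorder P]

/-- `p` forces `x = y`: whenever `⟨z, c⟩ ∈ x`, below every `q` above both `p` and `c` it is dense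
to be above some `d` with `⟨w, d⟩ ∈ y` and to force `z = w`; and symmetrically. -/
def FProp.eq : PName P → PName P → FProp P
  | ⟨ι, x, c⟩, ⟨κ, y, d⟩ => fun p =>
    (∀ i : ι, ∀ q, p ≤ q → c i ≤ q → ∃ r, q ≤ r ∧ ∃ j : κ, d j ≤ r ∧ FProp.eq (x i) (y j) r) ∧
    (∀ j : κ, ∀ q, p ≤ q → d j ≤ q → ∃ r, q ≤ r ∧ ∃ i : ι, c i ≤ r ∧ FProp.eq (x i) (y j) r)

/-- `p` forces `x ∈ y`: below `p` it is dense to be above some `d` with `⟨w, d⟩ ∈ y` and to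
force `x = w`. -/
def FProp.mem (x : PName P) : PName P → FProp P
  | ⟨κ, y, d⟩ => fun p => ∀ q, p ≤ q → ∃ r, q ≤ r ∧ ∃ j : κ, d j ≤ r ∧ FProp.eq x (y j) r

/-- A fact about ground model objects. -/
def FProp.ofProp (φ : Prop) : FProp P := fun _ => φ

def FProp.neg (φ : FProp P) : FProp P := fun p => ∀ q, p ≤ q → ¬ φ q

def FProp.and (φ ψ : FProp P) : FProp P := fun p => φ p ∧ ψ p

def FProp.imp (φ ψ : FProp P) : FProp P := fun p => ∀ q, p ≤ q → φ q → ψ q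

def FProp.iff (φ ψ : FProp P) : FProp P := (φ.imp ψ).and (ψ.imp φ)

/-- Universal quantification, over all names (`ι = PName P`) or over the elements of a ground
model set (`ι` a type of ground model objects). -/
def FProp.all {ι : Sort v} (φ : ι → FProp P) : FProp P := fun p => ∀ i, φ i p

/-- Existential quantification, over all names or over the elements of a ground model set. -/
def FProp.exist {ι : Sort v} (φ : ι → FProp P) : FProp P :=
  fun p => ∀ q, p ≤ q → ∃ r, q ≤ r ∧ ∃ i, φ i r

/-- `∀^∞ n, φ n`. -/
def FProp.eventually (φ : ℕ → FProp P) : FProp P :=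
  FProp.exist fun N : ℕ => FProp.all fun n : ℕ => (FProp.ofProp (N ≤ n)).imp (φ n)

/-- `∃^∞ n ∈ X, φ n`, for a ground model set `X`. -/
def FProp.infinitelyOften (X : Set ℕ) (φ : ℕ → FProp P) : FProp P :=
  FProp.all fun N : ℕ => FProp.exist fun n : ℕ => (FProp.ofProp (n ∈ X ∧ N ≤ n)).and (φ n)

/-- The condition `p` forces `φ`. -/
def Forces (p : P) (φ : FProp P) : Prop := φ p

/-- Every condition forces `φ`. -/
def ForcedByAll (φ : FProp P) : Prop := ∀ p, Forces p φ

end Language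

/-- The canonical name of a ground model set. -/
def PName.check (P : Type u) : PSet.{u} → PName P
  | ⟨α, A⟩ => PName.mk (α × P) (fun i => PName.check P (A i.1)) (fun i => i.2)

/-! Ground model objects as sets. -/

/-- Kuratowski pair. -/
def pairSet (x y : PSet.{u}) : PSet.{u} := {{x}, {x, y}}

def natSet (n : ℕ) : PSet.{u} := PSet.ofNat n

/-- A bit as an element of `2 = {0, 1}`. -/
def bitSet (b : Bool) : PSet.{u} := natSet (cond b 1 0)

/-- A finite `0`-`1` sequence as the set of pairs `⟨i, s i⟩`, `i < length s`. -/
def seqSet (s : List Bool) : PSet.{0} :=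
  PSet.mk (Fin s.length) fun i => pairSet (natSet i) (bitSet (s.get i))

/-- An element of the Cantor space as the set of pairs `⟨i, η i⟩`. -/
def realSet (η : ℕ → Bool) : PSet.{0} :=
  PSet.mk ℕ fun i => pairSet (natSet i) (bitSet (η i))

/-- A subset of `2^{<ω}`. -/
def seqsSet (S : Set (List Bool)) : PSet.{0} := PSet.mk S fun s => seqSet s

/-- A subset of the Cantor space. -/
def realsSet (W : Set (ℕ → Bool)) : PSet.{0} := PSet.mk W fun η => realSet η

/-! Properties of forcing notions. -/

section Properties

/-- `P` is a union of countably many sets each of which is centered: all its finite subsets have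
an upper bound in `P`. -/
def SigmaCentered (P : Type u) [Preorder P] : Prop :=
  ∃ D : ℕ → Set P, (⋃ n, D n) = Set.univ ∧
    ∀ n, ∀ F : Finset P, (F : Set P) ⊆ D n → ∃ q, ∀ p ∈ F, p ≤ q

variable {P : Type u} [Preorder P]

/-- "`f(n) = m`", i.e. `⟨n, m⟩ ∈ f`. -/
def FProp.value (f : PName P) (n m : ℕ) : FProp P :=
  FProp.mem (PName.check P (pairSet (natSet n) (natSet m))) f

/-- "`f` is a function from `ω` to `ω`". -/
def FProp.isFun (f : PName P) : FProp P :=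
  (FProp.all fun x : PName P => (FProp.mem x f).imp
    (FProp.exist fun n : ℕ => FProp.exist fun m : ℕ =>
      FProp.eq x (PName.check P (pairSet (natSet n) (natSet m))))).and
  ((FProp.all fun n : ℕ => FProp.exist fun m : ℕ => FProp.value f n m).and
   (FProp.all fun n : ℕ => FProp.all fun m : ℕ => FProp.all fun m' : ℕ =>
      ((FProp.value f n m).and (FProp.value f n m')).imp (FProp.ofProp (m = m'))))

/-- "`f(n) < k`". -/
def FProp.valueLT (f : PName P) (n k : ℕ) : FProp P :=
  FProp.exist fun m : ℕ => (FProp.ofProp (m < k)).and (FProp.value f n m)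

variable (P) in
/-- `P` is almost `ω^ω`-bounding. -/
def AlmostBounding : Prop :=
  ∀ f : PName P, ForcedByAll (FProp.isFun f) → ∀ p : P, ∃ g : ℕ → ℕ,
    ∀ X : Set ℕ, X.Infinite → ∃ p', p ≤ p' ∧
      Forces p' (FProp.infinitelyOften X fun n => FProp.valueLT f n (g n))

end Properties

/-! The forcing notion. -/

/-- The initial segment `η ↾ l`. -/
def restr (η : ℕ → Bool) (l : ℕ) : List Bool := List.ofFn fun i : Fin l => η i

/-- Conditions `⟨a, w⟩`: `a` a finite subset of `2^{<ω}`, `w` a finite subset of `2^ω`. -/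
@[ext]
structure QCirc : Type where
  a : Finset (List Bool)
  w : Finset (ℕ → Bool)

instance : LE QCirc where
  le c d := c.a ⊆ d.a ∧ c.w ⊆ d.w ∧ ∀ η ∈ c.w, ∀ l : ℕ, restr η l ∈ d.a → restr η l ∈ c.a

instance : Preorder QCirc where
  le_refl c := ⟨Finset.Subset.refl _, Finset.Subset.refl _, fun _ _ _ h => h⟩
  le_trans c d e h k := ⟨h.1.trans k.1, h.2.1.trans k.2.1,
    fun η hη l hl => h.2.2 η hη l (k.2.2 η (h.2.1 hη) l hl)⟩

/-- The condition `⟨a, w⟩` as a set. -/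
def QCirc.toSet (c : QCirc) : PSet.{0} := pairSet (seqsSet ↑c.a) (realsSet ↑c.w)

/-- The canonical name `{⟨č, c⟩ : c a condition}` of the generic filter. -/
def QCirc.Γ : PName QCirc := PName.mk QCirc (fun c => PName.check QCirc c.toSet) id

/-- It is forced that `A = ⋃ {a : ∃ w, ⟨a, w⟩ ∈ Γ}`. -/
def QCirc.IsGenericSetName (A : PName QCirc) : Prop :=
  ForcedByAll <| FProp.all fun x : PName QCirc => (FProp.mem x A).iff <|
    FProp.exist fun c : QCirc =>
      (FProp.mem (PName.check QCirc c.toSet) QCirc.Γ).and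
        (FProp.mem x (PName.check QCirc (seqsSet ↑c.a)))

/-- `T ⊆ 2^{<ω}` is a perfect tree: nonempty, closed under initial segments, and every node has a
splitting node above it. -/
def IsPerfectTree (T : Set (List Bool)) : Prop :=
  T.Nonempty ∧ T ∈ Descriptive.tree Bool ∧
    ∀ s ∈ T, ∃ t, s <+: t ∧ t ++ [false] ∈ T ∧ t ++ [true] ∈ T

end PForcing

open PForcing

/-! A condition is a finite approximation `a` to the generic set together with finitely many
branches `w` along which no further nodes may be added. There are only countably many `a`, and
conditions sharing one are compatible; this gives σ-centeredness.

The bounding property rests on compactness (`exists_value_bound`). If `r` extends `⟨a, w⟩` and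
decides `f(n)`, only the part of `w` up to the longest node of `r.a` matters, so `r` also serves,
after enlarging its promises, every tuple of branches near `w`. Finitely many such neighbourhoods
cover the space of `k`-tuples, so one bound works for all `w` of size `k`. Diagonalising over `a`
and `k` gives `g`.

For the generic set, promising `η` freezes the set along `η`, while a perfect tree always has long
nodes off finitely many branches, and these may be added freely. -/

namespace PForcing

universe u

/-! Atomic forcing relations. -/

section Atomic

variable {P : Type u} [Preorder P]

theorem FProp.eq_refl (x : PName P) (p : P) : FProp.eq x x p := by
  induction x generalizing p with
  | mk ι x c ih =>
    rw [FProp.eq]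
    exact ⟨fun i q _ hc => ⟨q, le_rfl, i, hc, ih i q⟩, fun i q _ hc => ⟨q, le_rfl, i, hc, ih i q⟩⟩

theorem FProp.eq_mono {x y : PName P} {p q : P} (hpq : p ≤ q) (h : FProp.eq x y p) :
    FProp.eq x y q := by
  cases x
  cases y
  rw [FProp.eq] at h ⊢
  exact ⟨fun i r hr => h.1 i r (hpq.trans hr), fun i r hr => h.2 i r (hpq.trans hr)⟩

theorem FProp.mem_mono {x y : PName P} {p q : P} (hpq : p ≤ q) (h : FProp.mem x y p) :
    FProp.mem x y q := by
  cases y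
  exact fun r hr => h r (hpq.trans hr)

theorem FProp.mem_mk {x : PName P} {κ : Type u} {y : κ → PName P} {d : κ → P} {p : P} :
    FProp.mem x (PName.mk κ y d) p ↔
      ∀ q, p ≤ q → ∃ r, q ≤ r ∧ ∃ j, d j ≤ r ∧ FProp.eq x (y j) r :=
  Iff.rfl

theorem FProp.mem_mk_self {κ : Type u} {y : κ → PName P} {d : κ → P} {p : P} (j : κ)
    (h : d j ≤ p) : FProp.mem (y j) (PName.mk κ y d) p :=
  fun q hq => ⟨q, le_rfl, j, h.trans hq, FProp.eq_refl _ _⟩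

theorem FProp.mem_check_mk {x : PName P} {α : Type u} {A : α → PSet.{u}} {p : P} :
    FProp.mem x (PName.check P (PSet.mk α A)) p ↔
      ∀ q, p ≤ q → ∃ r, q ≤ r ∧ ∃ j, FProp.eq x (PName.check P (A j)) r := by
  rw [PName.check, FProp.mem_mk]
  constructor
  · intro h q hq
    obtain ⟨r, hr, j, -, hj⟩ := h q hq
    exact ⟨r, hr, j.1, hj⟩
  · intro h q hq
    obtain ⟨r, hr, j, hj⟩ := h q hq
    -- A check name tags each element with every condition, so `r` can be its own tag.
    exact ⟨r, hr, (j, r), le_rfl, hj⟩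

theorem equiv_of_forces_eq_check {x y : PSet.{u}} {p : P}
    (h : FProp.eq (PName.check P x) (PName.check P y) p) : PSet.Equiv x y := by
  induction x generalizing y p with
  | mk α A ih =>
    obtain ⟨β, B⟩ := y
    rw [PName.check, PName.check, FProp.eq] at h
    refine ⟨fun a => ?_, fun b => ?_⟩
    · obtain ⟨r, -, j, -, hj⟩ := h.1 (a, p) p le_rfl le_rfl
      exact ⟨j.1, ih a hj⟩
    · obtain ⟨r, -, i, -, hi⟩ := h.2 (b, p) p le_rfl le_rfl
      exact ⟨i.1, ih i.1 hi⟩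

theorem FProp.value_mono {f : PName P} {n m : ℕ} {p q : P} (hpq : p ≤ q)
    (h : FProp.value f n m p) : FProp.value f n m q :=
  FProp.mem_mono hpq h

theorem FProp.valueLT_of_value {f : PName P} {n m k : ℕ} {p : P} (hm : m < k)
    (h : FProp.value f n m p) : FProp.valueLT f n k p :=
  fun q hq => ⟨q, le_rfl, m, hm, FProp.value_mono hq h⟩

theorem FProp.exists_value {f : PName P} (hf : ForcedByAll (FProp.isFun f)) (n : ℕ) (p : P) :
    ∃ q, p ≤ q ∧ ∃ m, FProp.value f n m q :=
  (hf p).2.1 n p le_rfl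

end Atomic

/-! The codings of ground model objects are injective. -/

/-- Rank is invariant under `PSet.Equiv`, so it separates the numerals. -/
theorem rank_natSet (n : ℕ) : (natSet.{u} n).rank = n := by
  induction n with
  | zero => exact PSet.rank_empty
  | succ n ih =>
    change (insert (natSet n) (natSet n) : PSet).rank = _
    rw [PSet.rank_insert, ih]
    simp

theorem natSet_inj {m n : ℕ} (h : PSet.Equiv (natSet.{u} m) (natSet.{u} n)) : m = n := by
  have := PSet.rank_congr h
  rw [rank_natSet, rank_natSet] at this
  exact_mod_cast this

theorem bitSet_inj {b c : Bool} (h : PSet.Equiv (bitSet.{u} b) (bitSet.{u} c)) : b = c := by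
  have := natSet_inj h
  revert this
  cases b <;> cases c <;> simp

theorem pairSet_inj {x y x' y' : PSet.{u}} (h : PSet.Equiv (pairSet x y) (pairSet x' y')) :
    PSet.Equiv x x' ∧ PSet.Equiv y y' := by
  have h' : ZFSet.pair (ZFSet.mk x) (ZFSet.mk y) = ZFSet.pair (ZFSet.mk x') (ZFSet.mk y') :=
    ZFSet.sound h
  obtain ⟨h₁, h₂⟩ := ZFSet.pair_inj.1 h'
  exact ⟨ZFSet.exact h₁, ZFSet.exact h₂⟩

theorem realSet_inj {η ν : ℕ → Bool} (h : PSet.Equiv (realSet η) (realSet ν)) : η = ν := by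
  funext i
  obtain ⟨j, hj⟩ := h.1 i
  obtain ⟨h₁, h₂⟩ := pairSet_inj hj
  obtain rfl := natSet_inj h₁
  exact bitSet_inj h₂

theorem seqSet_prefix {s t : List Bool} (h : PSet.Equiv (seqSet s) (seqSet t)) (i : ℕ)
    (hi : i < s.length) : ∃ hi' : i < t.length, s[i] = t[i] := by
  obtain ⟨j, hj⟩ := h.1 ⟨i, hi⟩
  obtain ⟨h₁, h₂⟩ := pairSet_inj hj
  have hij : i = j := natSet_inj h₁
  subst hij
  exact ⟨j.2, bitSet_inj h₂⟩

theorem seqSet_inj {s t : List Bool} (h : PSet.Equiv (seqSet s) (seqSet t)) : s = t := by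
  refine List.ext_getElem (le_antisymm ?_ ?_) fun i hi _ => (seqSet_prefix h i hi).2
  · by_contra! hlt
    exact absurd (seqSet_prefix h _ hlt).1 (lt_irrefl _)
  · by_contra! hlt
    exact absurd (seqSet_prefix h.symm _ hlt).1 (lt_irrefl _)

theorem subset_of_equiv_mk {α : Type u} {F : α → PSet.{u}}
    (hF : ∀ x y, PSet.Equiv (F x) (F y) → x = y) {S T : Set α}
    (h : PSet.Equiv (PSet.mk S fun s => F s) (PSet.mk T fun s => F s)) : S ⊆ T := by
  intro s hs
  obtain ⟨t, ht⟩ := h.1 ⟨s, hs⟩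
  rw [show s = t from hF _ _ ht]
  exact t.2

theorem seqsSet_inj {S T : Set (List Bool)} (h : PSet.Equiv (seqsSet S) (seqsSet T)) : S = T :=
  (subset_of_equiv_mk (fun _ _ => seqSet_inj) h).antisymm
    (subset_of_equiv_mk (fun _ _ => seqSet_inj) h.symm)

theorem realsSet_inj {S T : Set (ℕ → Bool)} (h : PSet.Equiv (realsSet S) (realsSet T)) : S = T :=
  (subset_of_equiv_mk (fun _ _ => realSet_inj) h).antisymm
    (subset_of_equiv_mk (fun _ _ => realSet_inj) h.symm)

theorem QCirc.toSet_inj {c d : QCirc} (h : PSet.Equiv c.toSet d.toSet) : c = d := by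
  obtain ⟨h₁, h₂⟩ := pairSet_inj h
  exact QCirc.ext (Finset.coe_injective (seqsSet_inj h₁)) (Finset.coe_injective (realsSet_inj h₂))

/-! Membership in check names of sets of sequences and in the generic filter. -/

section Membership

variable {P : Type} [Preorder P]

theorem FProp.mem_check_seqsSet {x : PName P} {S : Set (List Bool)} {p : P} :
    FProp.mem x (PName.check P (seqsSet S)) p ↔
      ∀ q, p ≤ q → ∃ r, q ≤ r ∧ ∃ s ∈ S, FProp.eq x (PName.check P (seqSet s)) r := by
  rw [seqsSet, FProp.mem_check_mk]
  simp

theorem FProp.check_seqSet_mem_check {s : List Bool} {S : Set (List Bool)} (hs : s ∈ S) (p : P) :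
    FProp.mem (PName.check P (seqSet s)) (PName.check P (seqsSet S)) p :=
  FProp.mem_check_seqsSet.2 fun q _ => ⟨q, le_rfl, s, hs, FProp.eq_refl _ _⟩

theorem mem_of_forces_mem_check {s : List Bool} {S : Set (List Bool)} {p : P}
    (h : FProp.mem (PName.check P (seqSet s)) (PName.check P (seqsSet S)) p) : s ∈ S := by
  obtain ⟨r, -, t, ht, hst⟩ := FProp.mem_check_seqsSet.1 h p le_rfl
  rwa [seqSet_inj (equiv_of_forces_eq_check hst)]

end Membership

namespace QCirc

/-- Codes of conditions are injective, so the witness for membership must be `c` itself. Only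
compatibility of `c` with `p` is extracted, which suffices for density arguments. -/
theorem exists_le_of_forces_mem_Γ {c p : QCirc}
    (h : FProp.mem (PName.check QCirc c.toSet) Γ p) : ∃ r, p ≤ r ∧ c ≤ r := by
  obtain ⟨r, hr, d, hd, hcd⟩ := h p le_rfl
  rw [toSet_inj (equiv_of_forces_eq_check hcd)]
  exact ⟨r, hr, hd⟩

theorem forces_mem_Γ {c p : QCirc} (h : c ≤ p) : FProp.mem (PName.check QCirc c.toSet) Γ p :=
  FProp.mem_mk_self (y := fun c : QCirc => PName.check QCirc c.toSet) (d := id) c h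

/-! The order of the forcing notion. -/

theorem isPartialOrder : IsPartialOrder QCirc (· ≤ ·) where
  refl := le_refl
  trans _ _ _ := le_trans
  antisymm _ _ h k := QCirc.ext (h.1.antisymm k.1) (h.2.1.antisymm k.2.1)

theorem length_restr (η : ℕ → Bool) (l : ℕ) : (restr η l).length = l := by
  simp [restr]

theorem restr_congr {η ν : ℕ → Bool} {l : ℕ} (h : ∀ i < l, η i = ν i) : restr η l = restr ν l := by
  unfold restr
  congr 1
  funext i
  exact h i i.2

/-- With the finite part fixed, uniting the promises adds no node and so breaks none of them. -/
theorem sigmaCentered : SigmaCentered QCirc := by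
  classical
  obtain ⟨e, he⟩ := exists_surjective_nat (Finset (List Bool))
  refine ⟨fun n => {c | c.a = e n}, ?_, fun n F hF => ⟨⟨e n, F.biUnion QCirc.w⟩, fun p hp => ?_⟩⟩
  · refine Set.eq_univ_of_forall fun c => ?_
    obtain ⟨n, hn⟩ := he c.a
    exact Set.mem_iUnion.2 ⟨n, hn.symm⟩
  · have hpa : p.a = e n := hF hp
    exact ⟨hpa.le, Finset.subset_biUnion_of_mem QCirc.w hp, fun η _ l hl => hpa ▸ hl⟩

/-- The compactness argument: over conditions with a fixed finite part and a fixed number of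
promises, some extension forces a value below a uniform bound. -/
theorem exists_value_bound {f : PName QCirc} (hf : ForcedByAll (FProp.isFun f))
    (a : Finset (List Bool)) (k n : ℕ) :
    ∃ M : ℕ, ∀ w : Finset (ℕ → Bool), w.card = k →
      ∃ r : QCirc, ⟨a, w⟩ ≤ r ∧ ∃ m < M, FProp.value f n m r := by
  classical
  -- Tuples, possibly with repetitions, replace `k`-element sets in order to work in a compact
  -- product space.
  let φ : (Fin k → ℕ → Bool) → ℕ → Prop := fun η M =>
    ∃ r : QCirc, ⟨a, Finset.univ.image η⟩ ≤ r ∧ ∃ m < M, FProp.value f n m r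
  suffices h : ∃ M, ∀ η ∈ (Set.univ : Set (Fin k → ℕ → Bool)), φ η M by
    obtain ⟨M, hM⟩ := h
    refine ⟨M, fun w hw => ?_⟩
    have hw' : Finset.univ.image (fun i => ((w.equivFinOfCardEq hw).symm i : ℕ → Bool)) = w := by
      ext η
      simp only [Finset.mem_image, Finset.mem_univ, true_and]
      constructor
      · rintro ⟨i, rfl⟩
        exact Subtype.coe_prop _
      · exact fun hη => ⟨w.equivFinOfCardEq hw ⟨η, hη⟩, by simp⟩
    have := hM (fun i => ((w.equivFinOfCardEq hw).symm i : ℕ → Bool)) trivial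
    simpa only [φ, hw'] using this
  refine isCompact_univ.induction_on (p := fun s => ∃ M, ∀ η ∈ s, φ η M) ⟨0, by simp⟩ ?_ ?_ ?_
  · rintro s t hst ⟨M, hM⟩
    exact ⟨M, fun η hη => hM η (hst hη)⟩
  · rintro s t ⟨M, hM⟩ ⟨N, hN⟩
    refine ⟨max M N, ?_⟩
    rintro η (hη | hη)
    · obtain ⟨r, hr, m, hm, h⟩ := hM η hη
      exact ⟨r, hr, m, hm.trans_le (le_max_left _ _), h⟩
    · obtain ⟨r, hr, m, hm, h⟩ := hN η hη
      exact ⟨r, hr, m, hm.trans_le (le_max_right _ _), h⟩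
  · intro η _
    obtain ⟨r, hr, m, hm⟩ := FProp.exists_value hf n ⟨a, Finset.univ.image η⟩
    set L := r.a.sup List.length
    have hnhds : ∀ᶠ ν in nhds η, ∀ i : Fin k, ∀ j : Fin L, ν i j = η i j := by
      refine Filter.eventually_all.2 fun i => Filter.eventually_all.2 fun j => ?_
      have hc : Continuous fun ν : Fin k → ℕ → Bool => ν i j := by fun_prop
      exact hc.continuousAt.eventually (show ∀ᶠ b in nhds (η i j), b = η i j by simp)
    refine ⟨{ν | ∀ i : Fin k, ∀ j : Fin L, ν i j = η i j}, ?_, m + 1, fun ν hν => ?_⟩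
    · rw [nhdsWithin_univ]
      exact hnhds
    -- No node of `r.a` is longer than `L`, and `ν` agrees with `η` below `L`, so `r` keeps the
    -- promises for `ν` because it keeps those for `η`.
    · have key : ∀ i : Fin k, ∀ l, restr (ν i) l ∈ r.a → restr (ν i) l ∈ a := by
        intro i l hl
        have hlL : l ≤ L := by
          have := Finset.le_sup (f := List.length) hl
          rwa [length_restr] at this
        rw [restr_congr fun j hj => hν i ⟨j, hj.trans_le hlL⟩] at hl ⊢
        exact hr.2.2 (η i) (Finset.mem_image_of_mem η (Finset.mem_univ i)) l hl
      refine ⟨⟨r.a, r.w ∪ Finset.univ.image ν⟩, ⟨hr.1, Finset.subset_union_right, ?_⟩, m,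
        Nat.lt_succ_self m, FProp.value_mono ?_ hm⟩
      · intro ζ hζ l hl
        obtain ⟨i, -, rfl⟩ := Finset.mem_image.1 hζ
        exact key i l hl
      · exact ⟨Finset.Subset.refl _, Finset.subset_union_left, fun _ _ _ h => h⟩

theorem almostBounding : AlmostBounding QCirc := by
  intro f hf p
  obtain ⟨e, he⟩ := exists_surjective_nat (Finset (List Bool))
  choose M hM using exists_value_bound hf
  -- `g n` dominates the bounds for the first `n + 1` finite parts and all sizes up to `n`. It
  -- depends on neither `p` nor `X`, and `p` itself serves as `p'`.
  refine ⟨fun n => (Finset.range (n + 1)).sup fun i => (Finset.range (n + 1)).sup fun k =>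
    M (e i) k n, fun X hX => ⟨p, le_rfl, fun N q _ => ?_⟩⟩
  obtain ⟨i, hi⟩ := he q.a
  obtain ⟨n, hnX, hn⟩ := hX.exists_gt (max N (max i q.w.card))
  simp only [max_lt_iff] at hn
  obtain ⟨r, hr, m, hm, hval⟩ := hM q.a q.w.card n q.w rfl
  refine ⟨r, hr, n, ⟨hnX, hn.1.le⟩, FProp.valueLT_of_value (hm.trans_le ?_) hval⟩
  rw [← hi]
  refine le_trans ?_ (Finset.le_sup (f := fun i => (Finset.range (n + 1)).sup fun k => M (e i) k n)
    (Finset.mem_range.2 (Nat.lt_succ_of_lt hn.2.1)))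
  exact Finset.le_sup (f := fun k => M (e i) k n) (Finset.mem_range.2 (Nat.lt_succ_of_lt hn.2.2))

/-! The generic set. -/

/-- A name for the union of the finite parts of the conditions in the generic filter. -/
def genericSet : PName QCirc :=
  PName.mk (Σ c : QCirc, {s // s ∈ c.a}) (fun i => PName.check QCirc (seqSet i.2)) fun i => i.1

theorem isGenericSetName_genericSet : IsGenericSetName genericSet := by
  refine fun p x => ⟨fun q _ hx q' hq' => ?_, fun q _ hx => FProp.mem_mk.2 fun q' hq' => ?_⟩
  · obtain ⟨r, hr, ⟨c, s, hs⟩, hc, hxs⟩ := FProp.mem_mk.1 hx q' hq'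
    exact ⟨r, hr, c, forces_mem_Γ hc, FProp.mem_check_seqsSet.2 fun r' hr' =>
      ⟨r', le_rfl, s, hs, FProp.eq_mono hr' hxs⟩⟩
  · obtain ⟨r, hr, c, hc, hxc⟩ := hx q' hq'
    obtain ⟨r₁, hr₁, hcr⟩ := exists_le_of_forces_mem_Γ hc
    obtain ⟨r₂, hr₂, s, hs, hxs⟩ := FProp.mem_check_seqsSet.1 hxc r₁ hr₁
    exact ⟨r₂, hr.trans (hr₁.trans hr₂), ⟨c, s, hs⟩, hcr.trans hr₂, hxs⟩

variable {A : PName QCirc}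

theorem IsGenericSetName.exists_of_forces_mem (hA : IsGenericSetName A) {x : PName QCirc}
    {p : QCirc} (h : FProp.mem x A p) :
    ∃ r, p ≤ r ∧ ∃ c ≤ r, FProp.mem x (PName.check QCirc (seqsSet ↑c.a)) r := by
  obtain ⟨r, hr, c, hc, hxc⟩ := (hA p x).1 p le_rfl h p le_rfl
  obtain ⟨r', hr', hcr⟩ := exists_le_of_forces_mem_Γ hc
  exact ⟨r', hr.trans hr', c, hcr, FProp.mem_mono hr' hxc⟩

theorem IsGenericSetName.forces_mem (hA : IsGenericSetName A) {s : List Bool} {p : QCirc}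
    (hs : s ∈ p.a) : FProp.mem (PName.check QCirc (seqSet s)) A p :=
  (hA p _).2 p le_rfl fun q hq =>
    ⟨q, le_rfl, p, forces_mem_Γ hq, FProp.check_seqSet_mem_check (S := ↑p.a) hs q⟩

theorem IsGenericSetName.exists_mem_of_forces_mem (hA : IsGenericSetName A) {s : List Bool}
    {p : QCirc} (h : FProp.mem (PName.check QCirc (seqSet s)) A p) : ∃ r, p ≤ r ∧ s ∈ r.a := by
  obtain ⟨r, hr, c, hc, hsc⟩ := hA.exists_of_forces_mem h
  exact ⟨r, hr, hc.1 (mem_of_forces_mem_check hsc)⟩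

theorem IsGenericSetName.subset (hA : IsGenericSetName A) :
    ForcedByAll (FProp.all fun x : PName QCirc =>
      (FProp.mem x A).imp (FProp.mem x (PName.check QCirc (seqsSet Set.univ)))) := by
  refine fun p x q _ hx => FProp.mem_check_seqsSet.2 fun q' hq' => ?_
  obtain ⟨r, hr, c, -, hxc⟩ := hA.exists_of_forces_mem (FProp.mem_mono hq' hx)
  obtain ⟨r', hr', s, -, hxs⟩ := FProp.mem_check_seqsSet.1 hxc r le_rfl
  exact ⟨r', hr.trans hr', s, trivial, hxs⟩

theorem IsGenericSetName.eventually_notMem (hA : IsGenericSetName A) :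
    ForcedByAll (FProp.all fun η : ℕ → Bool => FProp.eventually fun n =>
      (FProp.mem (PName.check QCirc (seqSet (restr η n))) A).neg) := by
  classical
  intro p η q _
  -- Once `η` is promised, its initial segments in the generic set already lie in `q.a`, which
  -- bounds their length.
  refine ⟨⟨q.a, insert η q.w⟩, ⟨Finset.Subset.refl _, Finset.subset_insert _ _, fun _ _ _ h => h⟩,
    q.a.sup List.length + 1, fun n q₁ hq₁ hn q₂ hq₂ hmem => ?_⟩
  obtain ⟨r, hr, hηr⟩ := hA.exists_mem_of_forces_mem hmem
  have hηq : restr η n ∈ q.a :=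
    (hq₁.trans (hq₂.trans hr)).2.2 η (Finset.mem_insert_self _ _) n hηr
  have hle := Finset.le_sup (f := List.length) hηq
  rw [length_restr] at hle
  have hn' : q.a.sup List.length + 1 ≤ n := hn
  omega

end QCirc

/-! ### Branches and perfect trees -/

theorem restr_succ (η : ℕ → Bool) (l : ℕ) : restr η (l + 1) = restr η l ++ [η l] := by
  rw [restr, List.ofFn_succ_last]
  rfl

theorem restr_prefix (η : ℕ → Bool) {l m : ℕ} (h : l ≤ m) : restr η l <+: restr η m := by
  induction m, h using Nat.le_induction with
  | base => exact List.prefix_rfl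
  | succ m _ ih =>
    rw [restr_succ]
    exact ih.trans (List.prefix_append _ _)

theorem eq_restr_of_prefix {s t : List Bool} {η : ℕ → Bool} (hst : s <+: t) {l : ℕ}
    (ht : t = restr η l) : s = restr η s.length := by
  have hl : s.length ≤ l := by
    have := hst.length_le
    rwa [ht, QCirc.length_restr] at this
  refine List.IsPrefix.eq_of_length ?_ (by rw [QCirc.length_restr])
  exact List.prefix_of_prefix_length_le (ht ▸ hst) (restr_prefix η hl) (by rw [QCirc.length_restr])

theorem IsPerfectTree.exists_append_mem {T : Set (List Bool)} (hT : IsPerfectTree T)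
    {s : List Bool} (hs : s ∈ T) : ∃ t, s <+: t ∧ ∀ b, t ++ [b] ∈ T := by
  obtain ⟨t, hst, h₀, h₁⟩ := hT.2.2 s hs
  exact ⟨t, hst, fun b => by cases b <;> assumption⟩

theorem IsPerfectTree.exists_le_length {T : Set (List Bool)} (hT : IsPerfectTree T) (N : ℕ) :
    ∃ s ∈ T, N ≤ s.length := by
  induction N with
  | zero => exact hT.1.imp fun s hs => ⟨hs, Nat.zero_le _⟩
  | succ N ih =>
    obtain ⟨s, hs, hN⟩ := ih
    obtain ⟨t, hst, ht⟩ := hT.exists_append_mem hs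
    refine ⟨t ++ [false], ht false, ?_⟩
    have := hst.length_le
    simp only [List.length_append, List.length_singleton]
    omega

/-- A perfect tree has long nodes off finitely many given branches. -/
theorem IsPerfectTree.exists_ne_restr {T : Set (List Bool)} (hT : IsPerfectTree T) (N : ℕ)
    (w : Finset (ℕ → Bool)) :
    ∃ s ∈ T, N ≤ s.length ∧ ∀ η ∈ w, ∀ l, s ≠ restr η l := by
  classical
  induction w using Finset.induction_on with
  | empty =>
    obtain ⟨s, hs, hN⟩ := hT.exists_le_length N
    exact ⟨s, hs, hN, by simp⟩
  | insert η w _ ih =>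
    obtain ⟨s, hs, hN, hw⟩ := ih
    obtain ⟨t, hst, ht⟩ := hT.exists_append_mem hs
    -- At the splitting node `t`, turn away from `η`; the branches in `w` stay avoided, since `s` is
    -- already off them.
    have hpre : s <+: t ++ [!η t.length] := hst.trans (List.prefix_append _ _)
    refine ⟨_, ht (!η t.length), hN.trans hpre.length_le, fun ν hν l hl => ?_⟩
    obtain rfl | hν := Finset.mem_insert.1 hν
    · have hlen : t.length + 1 = l := by
        simpa [QCirc.length_restr] using congrArg List.length hl
      rw [← hlen, restr_succ] at hl
      have := (List.append_inj' hl rfl).2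
      simp at this
    · exact hw ν hν _ (eq_restr_of_prefix hpre hl)

theorem QCirc.IsGenericSetName.infinitelyOften_perfectTree {A : PName QCirc}
    (hA : QCirc.IsGenericSetName A) :
    ForcedByAll (FProp.all fun T : {T : Set (List Bool) // IsPerfectTree T} =>
      FProp.infinitelyOften Set.univ fun n => FProp.exist fun x : PName QCirc =>
        (FProp.mem x (PName.check QCirc (seqsSet T.1))).and
          ((FProp.mem x (PName.check QCirc (seqsSet {s | s.length = n}))).and
            (FProp.mem x A))) := by
  classical
  rintro p ⟨T, hT⟩ N q _
  obtain ⟨s, hs, hN, hw⟩ := hT.exists_ne_restr N q.w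
  -- Since `s` lies on no branch of `q.w`, adding it violates no promise.
  refine ⟨⟨insert s q.a, q.w⟩, ⟨Finset.subset_insert _ _, Finset.Subset.refl _, ?_⟩, s.length,
    ⟨trivial, hN⟩, fun r hr => ⟨r, le_rfl, PName.check QCirc (seqSet s),
      FProp.check_seqSet_mem_check hs r, FProp.check_seqSet_mem_check (S := {t | t.length = s.length}) rfl r,
      hA.forces_mem (hr.1 (Finset.mem_insert_self _ _))⟩⟩
  intro η hη l hl
  exact (Finset.mem_insert.1 hl).resolve_left fun h => hw η hη l h.symm

end PForcing

open PForcing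
theorem mainTheorem10 :
    (IsPartialOrder QCirc (· ≤ ·) ∧ AlmostBounding QCirc ∧ SigmaCentered QCirc) ∧
    (∃ A : PName QCirc, QCirc.IsGenericSetName A) ∧
    (∀ A : PName QCirc, QCirc.IsGenericSetName A →
      -- `A` is a name for a subset of `2^{<ω}`
      ForcedByAll (FProp.all fun x : PName QCirc =>
        (FProp.mem x A).imp (FProp.mem x (PName.check QCirc (seqsSet Set.univ)))) ∧
      -- eventually avoids the initial segments of every ground model real
      ForcedByAll (FProp.all fun η : ℕ → Bool => FProp.eventually fun n =>
        (FProp.mem (PName.check QCirc (seqSet (restr η n))) A).neg) ∧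
      -- meets infinitely many levels of every ground model perfect tree
      ForcedByAll (FProp.all fun T : {T : Set (List Bool) // IsPerfectTree T} =>
        FProp.infinitelyOften Set.univ fun n => FProp.exist fun x : PName QCirc =>
          (FProp.mem x (PName.check QCirc (seqsSet T.1))).and
            ((FProp.mem x (PName.check QCirc (seqsSet {s | s.length = n}))).and
              (FProp.mem x A)))) := 
  ⟨⟨QCirc.isPartialOrder, QCirc.almostBounding, QCirc.sigmaCentered⟩,
    ⟨QCirc.genericSet, QCirc.isGenericSetName_genericSet⟩,
    fun _ hA => ⟨hA.subset, hA.eventually_notMem, hA.infinitelyOften_perfectTree⟩⟩
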